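/- Let $\mathbb{H}^2$ be the hyperbolic plane of constant curvature $-1$, let $\mathbb{H}^2\times\mathbb{R}$ carry the Riemannian product metric $\langle\cdot,\cdot\rangle$, and let $\partial_z$ be the unit vertical vector field. A \emph{translating soliton} is an orientable surface $M$ without boundary, smoothly immersed in $\mathbb{H}^2\times\mathbb{R}$, whose mean curvature $H_M$ (the mean of the two principal curvatures, i.e. half the trace of the second fundamental form) with respect to a unit normal field $\eta$ satisfies $H_M(p)=\langle\eta_p,\partial_z\rangle$ at every $p\in M$. \textbf{Theorem.} There does not exist a nonempty properly immersed translating soliton in $\mathbb{H}^2\times\mathbb{R}$ contained in a solid vertical cylinder of bounded radius. That is, if $\psi:M\to\mathbb{H}^2\times\mathbb{R}$ is a proper immersion of a nonempty surface that is a translating soliton, then there are no $c\in\mathbb{H}^2$ and $R\in\mathbb{R}$ such that $\psi(M)\subseteq\{(x,z)\in\mathbb{H}^2\times\mathbb{R} : d_{\mathbb{H}^2}(c,x)\le R\}$. -/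

import Mathlib

open scoped Manifold ContDiff

noncomputable section

namespace HypProd

/-- The Lorentz-Minkowski form `x₁y₁ + x₂y₂ - x₃y₃` on `ℝ³`. -/
def minkowski (x y : EuclideanSpace ℝ (Fin 3)) : ℝ :=
  x 0 * y 0 + x 1 * y 1 - x 2 * y 2

/-- The hyperbolic plane of curvature `-1` (hyperboloid model), with the subspace topology. -/
abbrev HyperbolicPlane : Type :=
  {x : EuclideanSpace ℝ (Fin 3) // minkowski x x = -1 ∧ 0 < x 2}

/-- The hyperbolic distance, `cosh d(x, y) = -⟨x, y⟩`. -/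
def hypDist (x y : HyperbolicPlane) : ℝ :=
  Real.arcosh (-minkowski x.1 y.1)

/-- The flat space `𝕃³ × ℝ`, with coordinates `(x₁, x₂, x₃, z)`, that contains `ℍ² × ℝ`. -/
abbrev Ambient : Type := EuclideanSpace ℝ (Fin 4)

/-- The flat metric `dx₁² + dx₂² - dx₃² + dz²` of `𝕃³ × ℝ`. On vectors tangent to `ℍ² × ℝ` it is
the (positive definite) Riemannian product metric of `ℍ² × ℝ`. -/
def metric (v w : Ambient) : ℝ :=
  v 0 * w 0 + v 1 * w 1 - v 2 * w 2 + v 3 * w 3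

/-- The inclusion of `ℍ² × ℝ` into `𝕃³ × ℝ`. -/
def incl (p : HyperbolicPlane × ℝ) : Ambient :=
  !₂[p.1.1 0, p.1.1 1, p.1.1 2, p.2]

/-- The vector `(x, 0)` at `p = (x, z)`; its orthogonal complement is the tangent space of
`ℍ² × ℝ` at `p`. -/
def radial (p : HyperbolicPlane × ℝ) : Ambient :=
  !₂[p.1.1 0, p.1.1 1, p.1.1 2, 0]

/-- The vertical unit Killing field `∂_z`. -/
def vertical : Ambient := !₂[0, 0, 0, 1]

/-- The solid vertical cylinder of radius `R` around the axis `{c} × ℝ`. -/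
def solidCylinder (c : HyperbolicPlane) (R : ℝ) : Set (HyperbolicPlane × ℝ) :=
  {p | hypDist c p.1 ≤ R}

/-- The model space of surfaces. -/
abbrev Plane : Type := EuclideanSpace ℝ (Fin 2)

section Surface

variable {M : Type*} [TopologicalSpace M] [ChartedSpace Plane M]

/-- `ψ` is a smooth immersion of the surface `M` into `ℍ² × ℝ`. -/
structure IsImmersedSurface (ψ : M → HyperbolicPlane × ℝ) : Prop where
  smooth : ContMDiff 𝓘(ℝ, Plane) 𝓘(ℝ, Ambient) ∞ (fun p => incl (ψ p))
  injective_mfderiv : ∀ p : M,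
    Function.Injective (mfderiv 𝓘(ℝ, Plane) 𝓘(ℝ, Ambient) (fun q => incl (ψ q)) p)

/-- `η` is a (continuous) unit normal vector field along `ψ` in `ℍ² × ℝ`: every `η p` is tangent to
`ℍ² × ℝ`, of unit length and orthogonal to the surface. Such a field exists exactly if the immersed
surface is orientable. -/
structure IsUnitNormal (ψ : M → HyperbolicPlane × ℝ) (η : M → Ambient) : Prop where
  continuous : Continuous η
  tangent : ∀ p, metric (η p) (radial (ψ p)) = 0
  unit : ∀ p, metric (η p) (η p) = 1
  normal : ∀ (p : M) (v : TangentSpace 𝓘(ℝ, Plane) p),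
    metric (η p) (mfderiv 𝓘(ℝ, Plane) 𝓘(ℝ, Ambient) (fun q => incl (ψ q)) p v) = 0

/-- The surface `ψ` read in the chart of `M` at `p`, as a local parametrization. -/
def localParam (ψ : M → HyperbolicPlane × ℝ) (p : M) (y : Plane) : Ambient :=
  incl (ψ ((extChartAt 𝓘(ℝ, Plane) p).symm y))

/-- The first partial derivative `∂ᵢF` of a map `F` of two variables. -/
def partialDeriv (F : Plane → Ambient) (i : Fin 2) (y : Plane) : Ambient :=
  fderiv ℝ F y (EuclideanSpace.single i 1)

/-- The first fundamental form `gᵢⱼ = ⟨∂ᵢF, ∂ⱼF⟩` at `p`, in the chart at `p`. -/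
def firstForm (ψ : M → HyperbolicPlane × ℝ) (p : M) : Matrix (Fin 2) (Fin 2) ℝ :=
  Matrix.of fun i j =>
    metric (partialDeriv (localParam ψ p) i (extChartAt 𝓘(ℝ, Plane) p p))
      (partialDeriv (localParam ψ p) j (extChartAt 𝓘(ℝ, Plane) p p))

/-- The second fundamental form `hᵢⱼ = ⟨∇_{∂ᵢ} ∂ⱼF, η⟩` at `p` with respect to `η`, in the chart at
`p`. Here `∇` is the Levi-Civita connection of `ℍ² × ℝ`; it is the tangential part of the flat
derivative of `𝕃³ × ℝ`, and since `η` is tangent to `ℍ² × ℝ`, the second partial derivatives of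
`F` may be used in its place. -/
def secondForm (ψ : M → HyperbolicPlane × ℝ) (η : M → Ambient) (p : M) :
    Matrix (Fin 2) (Fin 2) ℝ :=
  Matrix.of fun i j =>
    metric (partialDeriv (partialDeriv (localParam ψ p) j) i (extChartAt 𝓘(ℝ, Plane) p p)) (η p)

/-- The mean curvature with respect to `η`: half the trace of the second fundamental form
relative to the first, that is, the mean of the two principal curvatures. -/
def meanCurvature (ψ : M → HyperbolicPlane × ℝ) (η : M → Ambient) (p : M) : ℝ :=
  ((firstForm ψ p)⁻¹ * secondForm ψ η p).trace / 2

/-- The immersed surface `ψ` is a translating soliton: it is orientable and its mean curvature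
equals its angle function, `H = ⟨η, ∂_z⟩`, for a unit normal field `η` (the equation is invariant
under `η ↦ -η`). -/
structure IsTranslatingSoliton (ψ : M → HyperbolicPlane × ℝ) : Prop where
  immersed : IsImmersedSurface ψ
  exists_normal : ∃ η : M → Ambient, IsUnitNormal ψ η ∧
    ∀ p, meanCurvature ψ η p = metric (η p) vertical

end Surface

end HypProd

end

noncomputable section

namespace HypProd

open Filter Topology

/-! ### Linear algebra of the ambient metric -/

/-! The maximum principle is applied to f = u - √(1 + z²)/6 on the surface, where u = cosh d(c, x)
is minus the Minkowski product and so is linear on 𝕃³. Inside a cylinder u is bounded, so f → -∞ as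
|z| → ∞, and properness makes f attain its maximum (`exists_isMax_barrier`).

At a maximum let e₁, e₂ be an orthonormal tangent basis, η the normal, N the radial vector, A the
Lorentz gradient of f, W the sum of the flat second derivatives of the immersion along e₁, e₂, and k
the sum of the squared vertical components of e₁, e₂. Criticality gives A ⊥ e₁, e₂, so in the frame
e₁, e₂, η, N only η and N contribute: ⟨A, W⟩ = 2⟨η, ∂_z⟩⟨A, η⟩ + u(2 - k), using the soliton
equation and the hyperboloid constraint. Expanding ⟨A, ∂_z⟩ in the same way turns the first term
into 2⟨A, ∂_z⟩ ≥ -1/3. Since u ≥ 1 and k ≤ 1, ⟨A, W⟩ ≥ 2/3, while the second order condition gives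
⟨A, W⟩ ≤ k/6 ≤ 1/6 (`frame_contradiction`). The weight 1/6 is just a convenient value; this estimate
allows any positive weight below 1/3. -/

theorem metric_comm (v w : Ambient) : metric v w = metric w v := by
  simp only [metric]; ring

theorem metric_add_left (u v w : Ambient) : metric (u + v) w = metric u w + metric v w := by
  simp only [metric, PiLp.add_apply]; ring

theorem metric_smul_left (a : ℝ) (v w : Ambient) : metric (a • v) w = a * metric v w := by
  simp only [metric, PiLp.smul_apply, smul_eq_mul]; ring

theorem metric_add_right (u v w : Ambient) : metric u (v + w) = metric u v + metric u w := by
  simp only [metric, PiLp.add_apply]; ring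

theorem metric_smul_right (a : ℝ) (v w : Ambient) : metric v (a • w) = a * metric v w := by
  simp only [metric, PiLp.smul_apply, smul_eq_mul]; ring

/-- Completeness of a Lorentz orthonormal frame. -/
theorem metric_eq_sum_frame (e : Fin 4 → Ambient)
    (he : ∀ i j, metric (e i) (e j) =
      Matrix.diagonal (![1, 1, 1, -1] : Fin 4 → ℝ) i j) (v w : Ambient) :
    metric v w = metric v (e 0) * metric w (e 0) + metric v (e 1) * metric w (e 1)
      + metric v (e 2) * metric w (e 2) - metric v (e 3) * metric w (e 3) := by
  set X : Matrix (Fin 4) (Fin 4) ℝ := Matrix.of fun i j => e i j with hX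
  set K : Matrix (Fin 4) (Fin 4) ℝ := Matrix.diagonal ![1, 1, -1, 1] with hK
  set J : Matrix (Fin 4) (Fin 4) ℝ := Matrix.diagonal ![1, 1, 1, -1] with hJ
  have hKK : K * K = 1 := by
    rw [hK, Matrix.diagonal_mul_diagonal, ← Matrix.diagonal_one]
    congr 1; funext i; fin_cases i <;> simp
  have hJJ : J * J = 1 := by
    rw [hJ, Matrix.diagonal_mul_diagonal, ← Matrix.diagonal_one]
    congr 1; funext i; fin_cases i <;> simp
  have h1 : X * K * X.transpose = J := by
    ext i j
    rw [← he i j, Matrix.mul_apply]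
    simp [hK, hX, Matrix.mul_diagonal, Fin.sum_univ_four, metric]
    ring
  have h2 : (J * X * K) * X.transpose = 1 := by
    rw [← hJJ]; nth_rewrite 3 [← h1]; simp only [Matrix.mul_assoc]
  -- A one-sided inverse of a square matrix is two-sided: orthonormality of the rows becomes
  -- completeness.
  have h3 : X.transpose * J * X = K := by
    have h4 := mul_eq_one_comm.1 h2
    calc X.transpose * J * X = X.transpose * J * X * (K * K) := by rw [hKK, mul_one]
      _ = (X.transpose * (J * X * K)) * K := by simp only [Matrix.mul_assoc]
      _ = K := by rw [h4, one_mul]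
  have h5 : ∀ i j, e 0 i * e 0 j + e 1 i * e 1 j + e 2 i * e 2 j - e 3 i * e 3 j = K i j := by
    intro i j
    rw [← h3, Matrix.mul_apply]
    simp [hJ, hX, Matrix.mul_diagonal, Fin.sum_univ_four]
    ring
  have h6 : ∀ a b : Fin 4 → ℝ, (∑ i, ∑ j, a i * b j * K i j) =
      a 0 * b 0 + a 1 * b 1 - a 2 * b 2 + a 3 * b 3 := by
    intro a b
    simp [hK, Matrix.diagonal_apply, Fin.sum_univ_four]
    ring
  -- Negating the third entries lowers the index, so pairing with `e i` yields `metric v (e i)`.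
  have h7 := h6 ![v 0, v 1, -v 2, v 3] ![w 0, w 1, -w 2, w 3]
  simp only [← h5] at h7
  simp [Fin.sum_univ_four] at h7
  simp only [metric]
  linear_combination -h7

/-- The Riemannian metric is positive definite on tangent vectors of `ℍ² × ℝ`. -/
theorem metric_self_pos {p : HyperbolicPlane × ℝ} {v : Ambient}
    (hv : metric v (radial p) = 0) (h0 : v ≠ 0) : 0 < metric v v := by
  have hp := p.1.2.1
  have hp' := p.1.2.2
  simp [metric, radial, minkowski] at hv hp ⊢
  set a := p.1.1 0
  set b := p.1.1 1
  set c := p.1.1 2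
  have hc : 0 < c ^ 2 := by positivity
  have hcs : (v 2) ^ 2 * c ^ 2 ≤ (v 0 ^ 2 + v 1 ^ 2) * (c ^ 2 - 1) := by
    have h1 : v 2 * c = v 0 * a + v 1 * b := by linarith
    have h2 : c ^ 2 - 1 = a ^ 2 + b ^ 2 := by linarith
    rw [← mul_pow, h1, h2]
    nlinarith [sq_nonneg (v 0 * b - v 1 * a)]
  by_contra hneg
  push Not at hneg
  -- The negated goal times c², with Cauchy-Schwarz bounding the timelike term.
  have h3 : v 0 ^ 2 + v 1 ^ 2 + v 3 ^ 2 * c ^ 2 ≤ 0 := by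
    nlinarith
  have e0 : v 0 = 0 := by nlinarith [sq_nonneg (v 0), sq_nonneg (v 1), mul_nonneg (sq_nonneg (v 3)) hc.le]
  have e1 : v 1 = 0 := by nlinarith [sq_nonneg (v 0), sq_nonneg (v 1), mul_nonneg (sq_nonneg (v 3)) hc.le]
  have e3 : v 3 = 0 := by
    have : v 3 ^ 2 * c ^ 2 = 0 := by
      nlinarith [sq_nonneg (v 0), sq_nonneg (v 1), mul_nonneg (sq_nonneg (v 3)) hc.le]
    rcases mul_eq_zero.1 this with h | h
    · exact pow_eq_zero_iff (two_ne_zero) |>.1 h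
    · exact absurd h hc.ne'
  have e2 : v 2 = 0 := by
    have : v 2 * c = 0 := by rw [e0, e1] at hv; linarith
    exact (mul_eq_zero.1 this).resolve_right hp'.ne'
  apply h0
  ext i
  fin_cases i <;> simp [e0, e1, e2, e3]

/-! ### The height function and the barrier -/

theorem hasDerivAt_sqrt_one_add_sq (z : ℝ) :
    HasDerivAt (fun z : ℝ => √(1 + z ^ 2)) (z / √(1 + z ^ 2)) z := by
  have h : HasDerivAt (fun z : ℝ => 1 + z ^ 2) (2 * z) z := by
    simpa using (hasDerivAt_pow 2 z).const_add 1
  convert h.sqrt (by positivity) using 1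
  field_simp

theorem hasDerivAt_div_sqrt_one_add_sq (z : ℝ) :
    HasDerivAt (fun z : ℝ => z / √(1 + z ^ 2)) (1 / √(1 + z ^ 2) ^ 3) z := by
  have hpos : 0 < √(1 + z ^ 2) := by positivity
  have hs : √(1 + z ^ 2) ^ 2 = 1 + z ^ 2 := Real.sq_sqrt (by positivity)
  have h := (hasDerivAt_id z).div (hasDerivAt_sqrt_one_add_sq z) hpos.ne'
  have he : (1 * √(1 + z ^ 2) - id z * (z / √(1 + z ^ 2))) / √(1 + z ^ 2) ^ 2 =
      1 / √(1 + z ^ 2) ^ 3 := by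
    simp only [id]
    field_simp
    linarith
  rw [he] at h
  exact h

/-- The function `cosh d(c, x) - √(1 + z²) / 6`, extended to `𝕃³ × ℝ`. -/
def barrier (c : HyperbolicPlane) (v : Ambient) : ℝ :=
  -(c.1 0 * v 0 + c.1 1 * v 1 - c.1 2 * v 2) - √(1 + v 3 ^ 2) / 6

/-- The gradient of `barrier`. -/
def barrierGrad (c : HyperbolicPlane) (v : Ambient) : Ambient :=
  !₂[-c.1 0, -c.1 1, -c.1 2, -(v 3 / √(1 + v 3 ^ 2) / 6)]

/-- If b were positive, a would also be a local minimum, so f would be locally constant and b = 0.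
-/
theorem second_deriv_nonpos {f f' : ℝ → ℝ} {a b : ℝ} (hmax : IsLocalMax f a)
    (h1 : ∀ᶠ t in 𝓝 a, HasDerivAt f (f' t) t) (h2 : HasDerivAt f' b a) : b ≤ 0 := by
  by_contra! hb
  have hd : deriv f =ᶠ[𝓝 a] f' := h1.mono fun t ht => ht.deriv
  have hdd : deriv (deriv f) a = b := (hd.hasDerivAt_iff.2 h2).deriv
  have hmin := isLocalMin_of_deriv_deriv_pos (by rwa [hdd]) hmax.deriv_eq_zero
    h1.self_of_nhds.continuousAt
  have hconst : f =ᶠ[𝓝 a] fun _ => f a := by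
    filter_upwards [hmax, hmin] with t ht ht' using le_antisymm ht ht'
  have h0 : deriv (deriv f) a = 0 := by
    rw [hconst.deriv.deriv_eq]; simp
  linarith

theorem HasDerivAt.ambient_apply {γ : ℝ → Ambient} {v : Ambient} {t : ℝ}
    (h : HasDerivAt γ v t) (i : Fin 4) : HasDerivAt (fun s => γ s i) (v i) t :=
  (EuclideanSpace.proj i : Ambient →L[ℝ] ℝ).hasFDerivAt.comp_hasDerivAt t h

/-- First and second order conditions at a maximum of the barrier along a curve. -/
theorem barrier_curve {c : HyperbolicPlane} {γ v : ℝ → Ambient} {b : Ambient}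
    (hγ : ∀ᶠ t in 𝓝 0, HasDerivAt γ (v t) t) (hv : HasDerivAt v b 0)
    (hmax : IsLocalMax (fun t => barrier c (γ t)) 0) :
    metric (barrierGrad c (γ 0)) (v 0) = 0 ∧
      metric (barrierGrad c (γ 0)) b ≤ (v 0 3) ^ 2 / 6 := by
  set f' : ℝ → ℝ := fun t => -(c.1 0 * v t 0 + c.1 1 * v t 1 - c.1 2 * v t 2)
    - γ t 3 / √(1 + γ t 3 ^ 2) * v t 3 / 6 with hf'
  have h1 : ∀ᶠ t in 𝓝 0, HasDerivAt (fun t => barrier c (γ t)) (f' t) t := by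
    filter_upwards [hγ] with t ht
    have hs := (hasDerivAt_sqrt_one_add_sq (γ t 3)).comp t (HasDerivAt.ambient_apply ht 3)
    exact ((((HasDerivAt.ambient_apply ht 0).const_mul (c.1 0)).add
      ((HasDerivAt.ambient_apply ht 1).const_mul (c.1 1))).sub
      ((HasDerivAt.ambient_apply ht 2).const_mul (c.1 2))).neg.sub (hs.div_const 6)
  have h0 := hγ.self_of_nhds
  have h2 := ((((HasDerivAt.ambient_apply hv 0).const_mul (c.1 0)).add
      ((HasDerivAt.ambient_apply hv 1).const_mul (c.1 1))).sub
      ((HasDerivAt.ambient_apply hv 2).const_mul (c.1 2))).neg.sub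
      ((((hasDerivAt_div_sqrt_one_add_sq (γ 0 3)).comp 0 (HasDerivAt.ambient_apply h0 3)).mul
        (HasDerivAt.ambient_apply hv 3)).div_const 6)
  have h3 := second_deriv_nonpos (f' := f') hmax h1 h2
  have h4 := hmax.hasDerivAt_eq_zero h1.self_of_nhds
  simp only [Function.comp_apply] at h3
  -- The second derivative of √(1 + z²) is at most 1; the other part of the barrier is linear and
  -- has no Hessian.
  have h5 : 1 / √(1 + γ 0 3 ^ 2) ^ 3 ≤ 1 := by
    have : 1 ≤ √(1 + γ 0 3 ^ 2) := Real.one_le_sqrt.2 (by nlinarith [sq_nonneg (γ 0 3)])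
    rw [div_le_one (by positivity)]
    exact one_le_pow₀ this
  have h6 := mul_le_mul_of_nonneg_right h5 (sq_nonneg (v 0 3))
  constructor
  · simp [metric, barrierGrad]
    simp only [hf'] at h4
    linear_combination h4
  · simp [metric, barrierGrad]
    simp only [one_div] at h3 h6
    nlinarith

/-- Differentiating `⟨x, x⟩ = -1` twice along a curve. -/
theorem curve_constraint {q : ℝ → HyperbolicPlane × ℝ} {v : ℝ → Ambient} {b : Ambient}
    (hγ : ∀ᶠ t in 𝓝 0, HasDerivAt (fun t => incl (q t)) (v t) t) (hv : HasDerivAt v b 0) :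
    metric (v 0) (radial (q 0)) = 0 ∧
      metric b (radial (q 0)) = -(metric (v 0) (v 0) - (v 0 3) ^ 2) := by
  have key : ∀ᶠ t in 𝓝 0, v t 0 * incl (q t) 0 + v t 1 * incl (q t) 1
      - v t 2 * incl (q t) 2 = 0 := by
    filter_upwards [hγ] with t ht
    have a0 := HasDerivAt.ambient_apply ht 0
    have a1 := HasDerivAt.ambient_apply ht 1
    have a2 := HasDerivAt.ambient_apply ht 2
    have h := ((a0.mul a0).add (a1.mul a1)).sub (a2.mul a2)
    have hc : HasDerivAt (fun _ : ℝ => (-1 : ℝ)) 0 t := hasDerivAt_const _ _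
    have he : (fun _ : ℝ => (-1 : ℝ)) = (((fun s => incl (q s) 0) * fun s => incl (q s) 0) +
        ((fun s => incl (q s) 1) * fun s => incl (q s) 1)) -
        ((fun s => incl (q s) 2) * fun s => incl (q s) 2) := by
      funext s
      have := (q s).1.2.1
      simp [minkowski] at this
      simp [incl, this]
    rw [he] at hc
    have := hc.unique h
    linarith
  have h0 := hγ.self_of_nhds
  have k0 := key.self_of_nhds
  have d := (((HasDerivAt.ambient_apply hv 0).mul (HasDerivAt.ambient_apply h0 0)).add
    ((HasDerivAt.ambient_apply hv 1).mul (HasDerivAt.ambient_apply h0 1))).sub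
    ((HasDerivAt.ambient_apply hv 2).mul (HasDerivAt.ambient_apply h0 2))
  have d' : HasDerivAt (fun _ : ℝ => (0 : ℝ)) 0 0 := hasDerivAt_const _ _
  have := d'.unique (d.congr_of_eventuallyEq (key.mono fun t ht => ht.symm))
  simp [incl] at k0 this
  constructor
  · simp [metric, radial, k0]
  · simp [metric, radial]
    linarith

/-! ### The hyperboloid -/

/-- Reversed Cauchy-Schwarz for two timelike vectors on the same sheet. -/
theorem one_le_neg_minkowski (c x : HyperbolicPlane) : 1 ≤ -minkowski c.1 x.1 := by
  have hc := c.2.1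
  have hx := x.2.1
  have hc0 := c.2.2
  have hx0 := x.2.2
  simp only [minkowski] at hc hx ⊢
  generalize c.1 = c at *
  generalize x.1 = x at *
  have h : (1 + (c 0 * x 0 + c 1 * x 1)) ^ 2 ≤ (c 2 * x 2) ^ 2 := by
    have : (c 2 * x 2) ^ 2 = (1 + c 0 ^ 2 + c 1 ^ 2) * (1 + x 0 ^ 2 + x 1 ^ 2) := by
      rw [mul_pow]; congr 1 <;> linarith
    rw [this]
    nlinarith [sq_nonneg (c 0 - x 0), sq_nonneg (c 1 - x 1), sq_nonneg (c 0 * x 1 - c 1 * x 0)]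
  have := abs_le_of_sq_le_sq' h (by positivity)
  linarith [this.2]

/-- With r = √(c₂² - 1), Cauchy-Schwarz gives u ≥ (c₂ - r)x₂, and 1/(c₂ - r) = c₂ + r ≤ 2c₂. This
makes the sublevel sets of u bounded. -/
theorem height_le (c x : HyperbolicPlane) :
    x.1 2 ≤ 2 * c.1 2 * -minkowski c.1 x.1 := by
  have hc := c.2.1
  have hx := x.2.1
  have hc0 := c.2.2
  have hx0 := x.2.2
  simp only [minkowski] at hc hx ⊢
  generalize c.1 = c at *
  generalize x.1 = x at *
  set r := √(c 0 ^ 2 + c 1 ^ 2) with hr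
  have hr2 : r ^ 2 = c 2 ^ 2 - 1 := by
    rw [hr, Real.sq_sqrt (by positivity)]; linarith
  have hr0 : 0 ≤ r := Real.sqrt_nonneg _
  have h : (c 0 * x 0 + c 1 * x 1) ^ 2 ≤ (r * x 2) ^ 2 := by
    rw [mul_pow, hr2]
    have e1 : c 2 ^ 2 - 1 = c 0 ^ 2 + c 1 ^ 2 := by linarith
    have e2 : x 2 ^ 2 = 1 + x 0 ^ 2 + x 1 ^ 2 := by linarith
    rw [e1, e2]
    nlinarith [sq_nonneg (c 0 * x 1 - c 1 * x 0), sq_nonneg (c 0), sq_nonneg (c 1)]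
  have h1 := (abs_le_of_sq_le_sq' h (by positivity)).2
  have hrc : r ≤ c 2 := by nlinarith
  have h2 : x 2 * 1 ≤ x 2 * (2 * c 2 * (c 2 - r)) := by
    apply mul_le_mul_of_nonneg_left _ hx0.le
    nlinarith
  have h3 : 2 * c 2 * (c 0 * x 0 + c 1 * x 1) ≤ 2 * c 2 * (r * x 2) :=
    mul_le_mul_of_nonneg_left h1 (by positivity)
  nlinarith

theorem continuous_incl : Continuous incl := by
  unfold incl
  refine (PiLp.continuous_toLp 2 _).comp (continuous_pi fun i => ?_)
  fin_cases i <;> simp <;> fun_prop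

theorem isClosed_hyperbolicPlane :
    IsClosed {x : EuclideanSpace ℝ (Fin 3) | minkowski x x = -1 ∧ 0 < x 2} := by
  have : {x : EuclideanSpace ℝ (Fin 3) | minkowski x x = -1 ∧ 0 < x 2} =
      {x | minkowski x x = -1} ∩ {x | 0 ≤ x 2} := by
    ext x
    simp only [Set.mem_ofPred_eq, Set.mem_inter_iff, minkowski]
    refine and_congr_right fun h => ⟨le_of_lt, fun h2 => lt_of_le_of_ne h2 fun h3 => ?_⟩
    rw [← h3] at h
    nlinarith [sq_nonneg (x 0), sq_nonneg (x 1)]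
  rw [this]
  refine (isClosed_eq ?_ continuous_const).inter (isClosed_le continuous_const ?_)
  · unfold minkowski; fun_prop
  · fun_prop

theorem isCompact_solidCylinder_inter (c : HyperbolicPlane) (B C : ℝ) :
    IsCompact {p : HyperbolicPlane × ℝ | -minkowski c.1 p.1.1 ≤ B ∧ |p.2| ≤ C} := by
  have hprod : {p : HyperbolicPlane × ℝ | -minkowski c.1 p.1.1 ≤ B ∧ |p.2| ≤ C} =
      {x : HyperbolicPlane | -minkowski c.1 x.1 ≤ B} ×ˢ Set.Icc (-C) C := by
    ext p; simp [abs_le]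
  rw [hprod]
  refine IsCompact.prod ?_ isCompact_Icc
  have hsub : {x : HyperbolicPlane | -minkowski c.1 x.1 ≤ B} ⊆
      (Subtype.val : HyperbolicPlane → EuclideanSpace ℝ (Fin 3)) ⁻¹'
        Metric.closedBall 0 √(2 * (2 * c.1 2 * B) ^ 2) := by
    intro x hx
    simp only [Set.mem_preimage, mem_closedBall_zero_iff, EuclideanSpace.norm_eq,
      Fin.sum_univ_three, Real.norm_eq_abs, sq_abs]
    apply Real.sqrt_le_sqrt
    have h1 := height_le c x
    have h2 : 2 * c.1 2 * -minkowski c.1 x.1 ≤ 2 * c.1 2 * B :=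
      mul_le_mul_of_nonneg_left hx (by linarith [c.2.2])
    have h3 := x.2.1
    simp only [minkowski] at h3
    have h4 := pow_le_pow_left₀ x.2.2.le (h1.trans h2) 2
    linarith
  refine IsCompact.of_isClosed_subset
    (isClosed_hyperbolicPlane.isClosedEmbedding_subtypeVal.isCompact_preimage
      (isCompact_closedBall _ _)) ?_ hsub
  refine isClosed_le ?_ continuous_const
  unfold minkowski
  fun_prop

/-! ### Local parametrizations -/

section Surface

variable {M : Type*} [TopologicalSpace M] [ChartedSpace Plane M]

theorem contDiffAt_localParam [IsManifold 𝓘(ℝ, Plane) ∞ M] {ψ : M → HyperbolicPlane × ℝ}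
    (h : IsImmersedSurface ψ) (p : M) :
    ContDiffAt ℝ ∞ (localParam ψ p) (extChartAt 𝓘(ℝ, Plane) p p) := by
  have h1 := (contMDiffAt_iff.1 (h.smooth p)).2
  rw [modelWithCornersSelf_coe, Set.range_id, contDiffWithinAt_univ] at h1
  exact h1

theorem mfderiv_eq_fderiv_localParam {ψ : M → HyperbolicPlane × ℝ}
    (h : IsImmersedSurface ψ) (p : M) :
    mfderiv 𝓘(ℝ, Plane) 𝓘(ℝ, Ambient) (fun q => incl (ψ q)) p =
      fderiv ℝ (localParam ψ p) (extChartAt 𝓘(ℝ, Plane) p p) := by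
  have hd : MDifferentiableAt 𝓘(ℝ, Plane) 𝓘(ℝ, Ambient) (fun q => incl (ψ q)) p :=
    (h.smooth p).mdifferentiableAt (by simp)
  rw [hd.mfderiv]
  simp only [modelWithCornersSelf_coe, Set.range_id,
    fderivWithin_univ]
  rfl

end Surface

/-- First and second order conditions at a maximum of the barrier on a parametrized surface. -/
theorem barrier_surface {c : HyperbolicPlane} {q : Plane → HyperbolicPlane × ℝ} {y₀ : Plane}
    (hq : ContDiffAt ℝ ∞ (fun y => incl (q y)) y₀)
    (hmax : ∀ y, barrier c (incl (q y)) ≤ barrier c (incl (q y₀))) :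
    HasFDerivAt (fderiv ℝ fun y => incl (q y)) (fderiv ℝ (fderiv ℝ fun y => incl (q y)) y₀) y₀ ∧
    ∀ w : Plane,
      (metric (fderiv ℝ (fun y => incl (q y)) y₀ w) (radial (q y₀)) = 0 ∧
        metric (fderiv ℝ (fderiv ℝ fun y => incl (q y)) y₀ w w) (radial (q y₀)) =
          -(metric (fderiv ℝ (fun y => incl (q y)) y₀ w) (fderiv ℝ (fun y => incl (q y)) y₀ w)
            - (fderiv ℝ (fun y => incl (q y)) y₀ w 3) ^ 2)) ∧
      (metric (barrierGrad c (incl (q y₀))) (fderiv ℝ (fun y => incl (q y)) y₀ w) = 0 ∧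
        metric (barrierGrad c (incl (q y₀))) (fderiv ℝ (fderiv ℝ fun y => incl (q y)) y₀ w w) ≤
          (fderiv ℝ (fun y => incl (q y)) y₀ w 3) ^ 2 / 6) := by
  obtain ⟨F, hF⟩ : ∃ F : Plane → Ambient, F = fun y => incl (q y) := ⟨_, rfl⟩
  rw [← hF] at hq ⊢
  have hFd : ∀ᶠ y in 𝓝 y₀, HasFDerivAt F (fderiv ℝ F y) y := by
    have h1 : ContDiffAt ℝ 1 F y₀ := hq.of_le (by exact_mod_cast le_top)
    have : ∀ᶠ y in 𝓝 y₀, ContDiffAt ℝ 1 F y := h1.eventually (by simp)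
    exact this.mono fun y hy => (hy.differentiableAt (by simp)).hasFDerivAt
  have hF1 : ContDiffAt ℝ 1 (fderiv ℝ F) y₀ := hq.fderiv_right (by
    rw [one_add_one_eq_two]; exact WithTop.coe_le_coe.2 le_top)
  have hF2 : HasFDerivAt (fderiv ℝ F) (fderiv ℝ (fderiv ℝ F) y₀) y₀ :=
    (hF1.differentiableAt (by simp)).hasFDerivAt
  refine ⟨hF2, fun w => ?_⟩
  -- Restriction to lines through y₀ reduces everything to the one-variable conditions.
  have hline : ∀ t : ℝ, HasDerivAt (fun t : ℝ => y₀ + t • w) w t := fun t => by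
    simpa using ((hasDerivAt_id t).smul_const w).const_add y₀
  have hlim : Tendsto (fun t : ℝ => y₀ + t • w) (𝓝 0) (𝓝 y₀) := by
    simpa using (hline 0).continuousAt.tendsto
  have h1 : ∀ᶠ t : ℝ in 𝓝 0, HasDerivAt (fun t : ℝ => F (y₀ + t • w))
      (fderiv ℝ F (y₀ + t • w) w) t := by
    filter_upwards [hlim.eventually hFd] with t ht
    exact ht.comp_hasDerivAt t (hline t)
  have h2 : HasDerivAt (fun t : ℝ => fderiv ℝ F (y₀ + t • w) w)
      (fderiv ℝ (fderiv ℝ F) y₀ w w) 0 := by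
    have hD : HasFDerivAt (fun y => fderiv ℝ F y w)
        ((ContinuousLinearMap.apply ℝ Ambient w).comp (fderiv ℝ (fderiv ℝ F) y₀)) y₀ :=
      (ContinuousLinearMap.apply ℝ Ambient w).hasFDerivAt.comp y₀ hF2
    have hy : y₀ = y₀ + (0 : ℝ) • w := by simp
    exact hD.comp_hasDerivAt_of_eq 0 (hline 0) hy
  have hcon := curve_constraint (q := fun t : ℝ => q (y₀ + t • w)) (v := fun t => fderiv ℝ F (y₀ + t • w) w)
    (by simpa only [hF] using h1) h2
  have hbar := barrier_curve (c := c) h1 h2 (Filter.Eventually.of_forall fun t => by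
    simpa [hF] using hmax (y₀ + t • w))
  have hF0 : F y₀ = incl (q y₀) := by rw [hF]
  simp only [zero_smul, add_zero, hF0] at hcon hbar
  exact ⟨hcon, hbar⟩

/-- An orthonormalizing pair for a positive definite symmetric form on the plane; the trace of any
bilinear form with respect to the first is the sum over the pair. -/
theorem exists_orthonormal_pair (g : Matrix (Fin 2) (Fin 2) ℝ) (hsymm : g 0 1 = g 1 0)
    (hE : 0 < g 0 0) (hdet : 0 < g.det) :
    ∃ P : Fin 2 → Fin 2 → ℝ,
      (∀ a b, ∑ i, ∑ j, P a i * P b j * g i j = if a = b then 1 else 0) ∧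
      ∀ h : Matrix (Fin 2) (Fin 2) ℝ,
        (g⁻¹ * h).trace = ∑ a, ∑ i, ∑ j, P a i * P a j * h i j := by
  have hd : g.det = g 0 0 * g 1 1 - g 0 1 * g 1 0 := Matrix.det_fin_two g
  set E := g 0 0
  set D := g.det with hD
  set r := √E with hr
  set s := √(E * D) with hs
  have hr2 : r ^ 2 = E := Real.sq_sqrt hE.le
  have hs2 : s ^ 2 = E * D := Real.sq_sqrt (by positivity)
  have hr0 : 0 < r := Real.sqrt_pos.2 hE
  have hs0 : 0 < s := Real.sqrt_pos.2 (by positivity)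
  -- Gram-Schmidt: E b₁ - g₀₁ b₀ is orthogonal to b₀ and has square length E · det g = s².
  refine ⟨![![1 / r, 0], ![-g 0 1 / s, E / s]], ?_, ?_⟩
  · intro a b
    fin_cases a <;> fin_cases b <;> simp [Fin.sum_univ_two] <;> field_simp
    · exact hr2.symm
    · simp only [E]; ring
    · rw [← hsymm]; simp only [E]; ring
    · rw [hs2, hd, ← hsymm]; ring
  · intro h
    rw [Matrix.inv_def, Ring.inverse_eq_inv', Matrix.adjugate_fin_two]
    simp only [Matrix.trace_fin_two, Matrix.mul_apply, Fin.sum_univ_two, Matrix.smul_apply]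
    simp
    rw [← hD]
    field_simp
    rw [hr2, hs2, hd, ← hsymm]
    field_simp
    ring

/-- The drift Laplacian computation at a maximum of the barrier, in an orthonormal frame. -/
theorem frame_contradiction {c : HyperbolicPlane} {p : HyperbolicPlane × ℝ}
    {e₁ e₂ η W : Ambient} (h11 : metric e₁ e₁ = 1) (h22 : metric e₂ e₂ = 1)
    (h12 : metric e₁ e₂ = 0) (hη1 : metric η e₁ = 0) (hη2 : metric η e₂ = 0)
    (hηη : metric η η = 1) (h1N : metric e₁ (radial p) = 0) (h2N : metric e₂ (radial p) = 0)
    (hηN : metric η (radial p) = 0)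
    (hA1 : metric (barrierGrad c (incl p)) e₁ = 0) (hA2 : metric (barrierGrad c (incl p)) e₂ = 0)
    (hWη : metric W η = 2 * metric η vertical)
    (hWN : metric W (radial p) = -(2 - ((e₁ 3) ^ 2 + (e₂ 3) ^ 2)))
    (hAW : metric (barrierGrad c (incl p)) W ≤ ((e₁ 3) ^ 2 + (e₂ 3) ^ 2) / 6) : False := by
  have hNN : metric (radial p) (radial p) = -1 := by
    have := p.1.2.1
    simp only [minkowski] at this
    simp [metric, radial, this]
  have frame := metric_eq_sum_frame ![e₁, e₂, η, radial p] (by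
    intro i j
    fin_cases i <;> fin_cases j <;>
      simp [h11, h22, h12, hη1, hη2, hηη, h1N, h2N, hηN, hNN, metric_comm e₁ η, metric_comm e₂ η,
        metric_comm e₂ e₁, metric_comm (radial p)])
  simp at frame
  have hvert : ∀ v : Ambient, metric v vertical = v 3 := by
    intro v; simp [metric, vertical]
  -- These three expansions give 1 = k + η₃², then A₃ = ⟨A, η⟩η₃, then the value of ⟨A, W⟩.
  have fVV := frame vertical vertical
  have fAV := frame (barrierGrad c (incl p)) vertical
  have fAW := frame (barrierGrad c (incl p)) W
  simp only [metric_comm vertical, hvert] at fVV fAV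
  rw [hA1, hA2] at fAV fAW
  rw [hWη, hWN, hvert] at fAW
  have hN3 : radial p 3 = 0 := by simp [radial]
  have hV3 : vertical 3 = 1 := by simp [vertical]
  rw [hN3, hV3] at fVV
  rw [hN3] at fAV
  have hAN : metric (barrierGrad c (incl p)) (radial p) = -minkowski c.1 p.1.1 := by
    simp [metric, barrierGrad, radial, minkowski]; ring
  have hu := one_le_neg_minkowski c p.1
  rw [hAN] at fAW
  have hA3 : -(1 / 6) ≤ barrierGrad c (incl p) 3 := by
    simp [barrierGrad]
    set z := incl p 3
    have hz : z / √(1 + z ^ 2) ≤ 1 := by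
      rw [div_le_one (by positivity)]
      exact Real.le_sqrt_of_sq_le (by linarith)
    linarith
  have hk : (e₁ 3) ^ 2 + (e₂ 3) ^ 2 ≤ 1 := by nlinarith [sq_nonneg (η 3)]
  nlinarith

/-! ### The maximum principle on the soliton -/

section Surface

variable {M : Type*} [TopologicalSpace M] [ChartedSpace Plane M]

theorem IsTranslatingSoliton.not_isMax_barrier [IsManifold 𝓘(ℝ, Plane) ∞ M]
    {ψ : M → HyperbolicPlane × ℝ} (hψ : IsTranslatingSoliton ψ) (c : HyperbolicPlane) (p : M)
    (hmax : ∀ q, barrier c (incl (ψ q)) ≤ barrier c (incl (ψ p))) : False := by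
  obtain ⟨η, hη, hH⟩ := hψ.exists_normal
  have hp : (extChartAt 𝓘(ℝ, Plane) p).symm (extChartAt 𝓘(ℝ, Plane) p p) = p :=
    extChartAt_to_inv p
  obtain ⟨hF2, curve⟩ := barrier_surface (c := c)
    (q := fun y => ψ ((extChartAt 𝓘(ℝ, Plane) p).symm y)) (y₀ := extChartAt 𝓘(ℝ, Plane) p p)
    (contDiffAt_localParam hψ.immersed p)
    -- Outside the chart target the inverse chart still takes values in M, so the global maximum
    -- bounds every y.
    (fun y => by rw [hp]; exact hmax _)
  rw [hp] at curve
  change HasFDerivAt (fderiv ℝ (localParam ψ p)) (fderiv ℝ (fderiv ℝ (localParam ψ p))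
    (extChartAt 𝓘(ℝ, Plane) p p)) (extChartAt 𝓘(ℝ, Plane) p p) at hF2
  generalize hT : fderiv ℝ (fun y => incl (ψ ((extChartAt 𝓘(ℝ, Plane) p).symm y)))
    (extChartAt 𝓘(ℝ, Plane) p p) = T at curve
  generalize hD : fderiv ℝ (fderiv ℝ (fun y => incl (ψ ((extChartAt 𝓘(ℝ, Plane) p).symm y))))
    (extChartAt 𝓘(ℝ, Plane) p p) = D at curve
  change fderiv ℝ (localParam ψ p) (extChartAt 𝓘(ℝ, Plane) p p) = T at hT
  change fderiv ℝ (fderiv ℝ (localParam ψ p)) (extChartAt 𝓘(ℝ, Plane) p p) = D at hD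
  rw [hD] at hF2
  have hmf := mfderiv_eq_fderiv_localParam hψ.immersed p
  rw [hT] at hmf
  have hinj : Function.Injective T := by
    have := hψ.immersed.injective_mfderiv p
    rw [hmf] at this
    exact this
  have hnormal : ∀ w : Plane, metric (η p) (T w) = 0 := by
    intro w
    have := hη.normal p w
    rw [hmf] at this
    exact this
  set b : Fin 2 → Plane := fun i => EuclideanSpace.single i 1 with hb
  have hgij : ∀ i j, firstForm ψ p i j = metric (T (b i)) (T (b j)) := by
    intro i j
    rw [← hT]
    rfl
  have hhij : ∀ i j, secondForm ψ η p i j = metric (D (b i) (b j)) (η p) := by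
    intro i j
    have h := (hF2.clm_apply (hasFDerivAt_const (b j) _)).fderiv
    have h' := congrArg (fun L : Plane →L[ℝ] Ambient => L (b i)) h
    simp only [_root_.add_apply, ContinuousLinearMap.comp_apply,
      _root_.zero_apply, map_zero, zero_add, ContinuousLinearMap.flip_apply] at h'
    rw [← h']
    rfl
  have hpos : ∀ w : Plane, w ≠ 0 → 0 < metric (T w) (T w) := fun w hw =>
    metric_self_pos (curve w).1.1 fun h => hw (hinj (h.trans (map_zero T).symm))
  have hb0 : b 0 ≠ 0 := by simp [hb]
  have hE : 0 < firstForm ψ p 0 0 := by rw [hgij]; exact hpos _ hb0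
  have hsymm : firstForm ψ p 0 1 = firstForm ψ p 1 0 := by
    rw [hgij, hgij, metric_comm]
  have hdet : 0 < (firstForm ψ p).det := by
    set E := firstForm ψ p 0 0 with hEdef
    set G := firstForm ψ p 0 1 with hGdef
    -- The square length of the image of this vector is E · det g, so positivity of the metric gives
    -- det g > 0.
    have hw : E • b 1 + (-G) • b 0 ≠ 0 := by
      intro h
      have := congrArg (fun v : Plane => v 1) h
      simp [hb] at this
      exact hE.ne' this
    have h := hpos _ hw
    simp only [map_add, map_smul, metric_add_left, metric_add_right, metric_smul_left,
      metric_smul_right, ← hgij] at h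
    rw [← hsymm, ← hEdef, ← hGdef] at h
    rw [Matrix.det_fin_two, ← hsymm, ← hEdef, ← hGdef]
    have : 0 < E * (E * firstForm ψ p 1 1 - G * G) := by nlinarith
    exact pos_of_mul_pos_right this hE.le
  obtain ⟨P, hP1, hP2⟩ := exists_orthonormal_pair _ hsymm hE hdet
  set w : Fin 2 → Plane := fun a => ∑ i, P a i • b i with hw
  have hTw : ∀ a a', metric (T (w a)) (T (w a')) = if a = a' then 1 else 0 := by
    intro a a'
    rw [← hP1 a a']
    simp only [hw, Fin.sum_univ_two, map_add, map_smul, metric_add_left, metric_add_right,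
      metric_smul_left, metric_smul_right, hgij]
    ring
  -- The trace of the second form over an orthonormal pair is 2H; here the soliton equation enters.
  have hWη : metric (D (w 0) (w 0) + D (w 1) (w 1)) (η p) = 2 * metric (η p) vertical := by
    rw [← hH p, meanCurvature, hP2]
    simp only [hw, Fin.sum_univ_two, map_add, map_smul, _root_.add_apply,
      _root_.smul_apply, metric_add_left, metric_smul_left, hhij]
    ring
  obtain ⟨⟨a1, a2⟩, a3, a4⟩ := curve (w 0)
  obtain ⟨⟨b1, b2⟩, b3, b4⟩ := curve (w 1)
  have t00 := hTw 0 0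
  have t11 := hTw 1 1
  have t01 := hTw 0 1
  simp only [if_true] at t00 t11
  refine frame_contradiction (c := c) t00 t11 (by simpa using t01) (hnormal _) (hnormal _)
    (hη.unit p) a1 b1 (hη.tangent p) a3 b3 hWη ?_ ?_
  · rw [metric_add_left, a2, b2, t00, t11]; ring
  · rw [metric_add_right]; linarith

end Surface

theorem exists_isMax_barrier {M : Type*} [TopologicalSpace M] [Nonempty M] {ψ : M → HyperbolicPlane × ℝ} (hproper : IsProperMap ψ)
    {c : HyperbolicPlane} {R : ℝ} (h : Set.range ψ ⊆ solidCylinder c R) :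
    ∃ p, ∀ q, barrier c (incl (ψ q)) ≤ barrier c (incl (ψ p)) := by
  obtain ⟨p₀⟩ := ‹Nonempty M›
  have hbar : ∀ q, barrier c (incl (ψ q)) =
      -minkowski c.1 (ψ q).1.1 - √(1 + (ψ q).2 ^ 2) / 6 := by
    intro q; simp [barrier, incl, minkowski]
  have hu : ∀ q, -minkowski c.1 (ψ q).1.1 ≤ Real.cosh R := by
    intro q
    have h1 := one_le_neg_minkowski c (ψ q).1
    have h2 : hypDist c (ψ q).1 ≤ R := h ⟨q, rfl⟩
    have h3 := Real.arcosh_nonneg h1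
    rw [← Real.cosh_arcosh h1, Real.cosh_le_cosh, abs_of_nonneg h3]
    exact h2.trans (le_abs_self R)
  -- Where f is at least its value at p₀, √(1 + z²)/6 ≤ cosh R - f(p₀), which bounds |z| by C; so
  -- the maximum need only be sought in the preimage of a compact set.
  set C := 6 * (Real.cosh R - barrier c (incl (ψ p₀))) with hC
  have hz : ∀ q, barrier c (incl (ψ p₀)) ≤ barrier c (incl (ψ q)) → |(ψ q).2| ≤ C := by
    intro q hq
    have h1 : |(ψ q).2| ≤ √(1 + (ψ q).2 ^ 2) := Real.abs_le_sqrt (by linarith)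
    have h2 := hu q
    rw [hbar q] at hq
    linarith
  have hK := hproper.isCompact_preimage (isCompact_solidCylinder_inter c (Real.cosh R) C)
  have hcont : Continuous fun q => barrier c (incl (ψ q)) := by
    have := continuous_incl.comp hproper.continuous
    have hb : Continuous (barrier c) := by unfold barrier; fun_prop
    exact hb.comp this
  obtain ⟨p, -, hp⟩ := hK.exists_isMaxOn ⟨p₀, hu p₀, hz p₀ le_rfl⟩ hcont.continuousOn
  have hp₀ : barrier c (incl (ψ p₀)) ≤ barrier c (incl (ψ p)) := hp ⟨hu p₀, hz p₀ le_rfl⟩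
  refine ⟨p, fun q => ?_⟩
  rcases le_total (barrier c (incl (ψ p₀))) (barrier c (incl (ψ q))) with hq | hq
  · exact hp ⟨hu q, hz q hq⟩
  · exact hq.trans hp₀

end HypProd

end

theorem mainTheorem9 {M : Type*} [TopologicalSpace M] [T2Space M] [SecondCountableTopology M]
    [Nonempty M] [ChartedSpace HypProd.Plane M] [IsManifold 𝓘(ℝ, HypProd.Plane) ∞ M]
    (ψ : M → HypProd.HyperbolicPlane × ℝ)
    (hsol : HypProd.IsTranslatingSoliton ψ) (hproper : IsProperMap ψ) :
    ¬ ∃ (c : HypProd.HyperbolicPlane) (R : ℝ), Set.range ψ ⊆ HypProd.solidCylinder c R := by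
  rintro ⟨c, R, h⟩
  obtain ⟨p, hp⟩ := HypProd.exists_isMax_barrier hproper h
  exact hsol.not_isMax_barrier c p hp
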